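/- A hypergraph is a pair $(V,E)$ where $V$ is a finite set of vertices and $E$ is a multiset of subsets of $V$, each containing at least two vertices. A walk is a sequence $v_0,e_1,v_1,\dots,e_m,v_m$ with $v_i\in V$, $e_i\in E$ and $\{v_{i-1},v_i\}\subseteq e_i$; it is a path if all $v_i$ are distinct and all $e_i$ are distinct, and a cycle if $m\ge 2$, all $e_i$ are distinct, and all $v_i$ are distinct except that $v_0=v_m$ (copies of a repeated edge count as different edges). A hypergraph is connected if any two vertices are joined by a path, and a hypertree is a connected hypergraph with no cycles. A labeled hypergraph on $[n]$ with $\lambda_i$ edges of size $i$ ($i\ge2$) has its vertices labeled by $[n]$ and, for each $i$, its edges of size $i$ labeled by $[\lambda_i]$. For $n\ge 1$ and a finitely supported sequence $\lambda=(\lambda_2,\lambda_3,\dots)$ of nonnegative integers, let $\tau_{n,\lambda}$ be the number of labeled hypertrees on $[n]$ with $\lambda_i$ edges of size $i$ for each $i$, and let $\rho_{n,\lambda}$ be the number of such labeled hypertrees together with a distinguished vertex (the root). Put $$T=\sum_{n\ge1}\sum_\lambda \tau_{n,\lambda}\,\frac{t^n}{n!}\prod_{i\ge2}\frac{u_i^{\lambda_i}}{\lambda_i!},\qquad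 R=\sum_{n\ge1}\sum_\lambda \rho_{n,\lambda}\,\frac{t^n}{n!}\prod_{i\ge2}\frac{u_i^{\lambda_i}}{\lambda_i!},$$ as formal power series in the indeterminates $t,u_2,u_3,\dots$ over $\mathbb{Q}$. Then $R=t\,\dfrac{\partial T}{\partial t}$, and, as an identity of formal power series (in which all compositions are well defined), $$R=t\exp\Bigl(\sum_{j=1}^{\infty}u_{j+1}\frac{R^j}{j!}\Bigr).$$ -/

import Mathlib

/-- A hypergraph with vertex set `V` whose edges form a multiset of subsets of `V`, each with at
least two vertices. The multiset is given as a family indexed by a type `E`, so that multiple edges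
are allowed and are told apart by their index. -/
@[ext]
structure MultiHypergraph (V E : Type*) where
  /-- the set of vertices of an edge -/
  verts : E → Finset V
  two_le_card : ∀ e, 2 ≤ (verts e).card

namespace MultiHypergraph

variable {V E : Type*} (H : MultiHypergraph V E) {m : ℕ}

/-- `v 0, e 0, v 1, e 1, …, e (m - 1), v m` is a walk: each edge contains the vertex before it and
the vertex after it. -/
def IsWalk (v : Fin (m + 1) → V) (e : Fin m → E) : Prop :=
  ∀ i : Fin m, v i.castSucc ∈ H.verts (e i) ∧ v i.succ ∈ H.verts (e i)

/-- A path is a walk in which all vertices are distinct and all edges are distinct. -/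
def IsPath (v : Fin (m + 1) → V) (e : Fin m → E) : Prop :=
  H.IsWalk v e ∧ Function.Injective v ∧ Function.Injective e

/-- A cycle is a walk with at least two edges in which all edges are distinct and all vertices are
distinct, except that the first vertex equals the last. -/
def IsCycle (v : Fin (m + 1) → V) (e : Fin m → E) : Prop :=
  H.IsWalk v e ∧ 2 ≤ m ∧ Function.Injective e ∧
    v 0 = v (Fin.last m) ∧ Function.Injective fun i : Fin m => v i.castSucc

/-- Any two vertices are joined by a path. -/
def IsConnected : Prop :=
  ∀ x y : V, ∃ (m : ℕ) (v : Fin (m + 1) → V) (e : Fin m → E),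
    H.IsPath v e ∧ v 0 = x ∧ v (Fin.last m) = y

/-- A hypertree is a connected hypergraph with no cycles. -/
def IsHypertree : Prop :=
  H.IsConnected ∧ ∀ (m : ℕ) (v : Fin (m + 1) → V) (e : Fin m → E), ¬ H.IsCycle v e

end MultiHypergraph

/-- A labeled hypergraph on `n` vertices with `lam i` edges of size `i` for each `i`: the vertices
are labeled by `Fin n`, and for each `i` the edges of size `i` are labeled by `Fin (lam i)`.
There is none if `lam 0 ≠ 0` or `lam 1 ≠ 0`, because edges have at least two vertices. -/
@[ext]
structure LabeledHypergraph (n : ℕ) (lam : ℕ →₀ ℕ) extends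
    MultiHypergraph (Fin n) (Σ i : ℕ, Fin (lam i)) where
  card_verts : ∀ x : (Σ i : ℕ, Fin (lam i)), (verts x).card = x.1

/-- There are finitely many edge labels. -/
instance finite_edgeLabels (lam : ℕ →₀ ℕ) : Finite (Σ i : ℕ, Fin (lam i)) := by
  refine Finite.of_injective
    (fun x : (Σ i : ℕ, Fin (lam i)) =>
      (⟨⟨x.1, Finsupp.mem_support_iff.2 (by have := x.2.isLt; omega)⟩, x.2⟩ :
        Σ i : lam.support, Fin (lam i))) ?_
  rintro ⟨i, a⟩ ⟨j, b⟩ h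
  simp only [Sigma.mk.injEq, Subtype.mk.injEq] at h
  obtain ⟨rfl, h⟩ := h
  simpa using h

/-- There are finitely many labeled hypergraphs of a given type. -/
instance finite_labeledHypergraph (n : ℕ) (lam : ℕ →₀ ℕ) : Finite (LabeledHypergraph n lam) :=
  Finite.of_injective (fun H : LabeledHypergraph n lam => H.verts)
    fun _ _ h => LabeledHypergraph.ext h

/-- The number of labeled hypertrees on `n` vertices with `lam i` edges of size `i`. -/
noncomputable def hypertreeCount (n : ℕ) (lam : ℕ →₀ ℕ) : ℕ :=
  Nat.card {H : LabeledHypergraph n lam // H.toMultiHypergraph.IsHypertree}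

/-- The number of labeled hypertrees on `n` vertices with `lam i` edges of size `i`, together with a
distinguished vertex, the root. -/
noncomputable def rootedHypertreeCount (n : ℕ) (lam : ℕ →₀ ℕ) : ℕ :=
  Nat.card {p : LabeledHypergraph n lam × Fin n // p.1.toMultiHypergraph.IsHypertree}

/-- The ring of formal power series over `ℚ` in the indeterminates `u i`. -/
abbrev EdgeRing : Type := MvPowerSeries ℕ ℚ

/-- The power series in the `u i` with coefficient `f lam` at `∏ i, (u i) ^ (lam i)`. -/
def EdgeRing.ofCoeff (f : (ℕ →₀ ℕ) → ℚ) : EdgeRing := f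

theorem EdgeRing.coeff_ofCoeff (f : (ℕ →₀ ℕ) → ℚ) (lam : ℕ →₀ ℕ) :
    MvPowerSeries.coeff lam (EdgeRing.ofCoeff f) = f lam := rfl

/-- The exponential generating function
`∑ n, ∑ lam, c n lam * (t ^ n / n!) * ∏ i, (u i) ^ (lam i) / (lam i)!`,
as a power series in `t` over the power series in the `u i`. -/
noncomputable def egf (c : ℕ → (ℕ →₀ ℕ) → ℕ) : PowerSeries EdgeRing :=
  PowerSeries.mk fun n => EdgeRing.ofCoeff fun lam =>
    (c n lam : ℚ) / ((n.factorial : ℚ) * lam.prod fun _ k => (k.factorial : ℚ))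

/-- The exponential generating function `T` of labeled hypertrees on at least one vertex. -/
noncomputable def hypertreeEGF : PowerSeries EdgeRing :=
  egf fun n lam => if n = 0 then 0 else hypertreeCount n lam

/-- The exponential generating function `R` of vertex-rooted labeled hypertrees. -/
noncomputable def rootedHypertreeEGF : PowerSeries EdgeRing :=
  egf rootedHypertreeCount

/-- The power series `∑_{j ≥ 1} u (j + 1) * x ^ j / j!` in `x`. -/
noncomputable def edgeSeries : PowerSeries EdgeRing :=
  PowerSeries.mk fun j =>
    if j = 0 then 0 else ((j.factorial : ℚ)⁻¹) • (MvPowerSeries.X (j + 1) : EdgeRing)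

/-! Rooted hypertrees are counted explicitly, and Lagrange inversion turns the count into the
functional equation. Rooting a hypertree at `r` splits each edge into the vertex nearest to `r`, its
parent, and the remaining vertices, its children. Child sets are disjoint and only `r` is nobody's
child, so this is a rooted forest with a single root. Forests are built edge by edge. On `n`
vertices the new parent is arbitrary, and the new children are any roots other than the root of the
parent's component. The number of choices depends only on the edge sizes
(`RootedForest.card_option`). The product gives `n ^ lam.degree * (n - 1)! / ∏ (i - 1)! ^ lam i`
rooted hypertrees when `n = 1 + ∑ (i - 1) * lam i`, and none otherwise. With `φ = exp (edgeSeries)`,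
the coefficients of `φ ^ n` follow from a differential equation. Comparison with the count yields `n
[t ^ n] R = [x ^ (n - 1)] φ ^ n`, which characterizes the solution of `R = t * φ(R)`. -/

namespace PowerSeries

/-! ### Linear differential equations and Lagrange inversion for formal power series. -/

theorem eq_zero_of_derivative_eq_mul {A : Type*} [CommRing A] [IsAddTorsionFree A]
    {c f : PowerSeries A} (hf : derivative A f = c * f) (h0 : constantCoeff f = 0) : f = 0 := by
  ext n
  induction n using Nat.strong_induction_on with
  | _ n ih =>
    cases n with
    | zero => simpa using h0
    | succ n =>
      have h := congrArg (coeff n) hf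
      rw [coeff_derivative, coeff_mul, Finset.sum_eq_zero] at h
      · have h' : (n + 1) • coeff (n + 1) f = 0 := by
          rw [nsmul_eq_mul, mul_comm]; exact_mod_cast h
        exact nsmul_right_injective (Nat.succ_ne_zero n) (h'.trans (nsmul_zero _).symm)
      · rintro ⟨i, j⟩ hij
        have := Finset.HasAntidiagonal.mem_antidiagonal.1 hij
        simp only at this ⊢
        rw [ih j (by omega)]
        simp

theorem eq_of_derivative_eq_mul {A : Type*} [CommRing A] [IsAddTorsionFree A]
    {c f g : PowerSeries A} (hf : derivative A f = c * f) (hg : derivative A g = c * g)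
    (h0 : constantCoeff f = constantCoeff g) : f = g := by
  rw [← sub_eq_zero]
  apply eq_zero_of_derivative_eq_mul (c := c)
  · rw [map_sub, hf, hg, mul_sub]
  · rw [map_sub, h0, sub_self]

/-- As `φ = X / h`, this coefficient is the residue of `h' / h ^ (n + 2)`, a derivative up to a
scalar. Without Laurent series: `n + 1` times the product is `(n + 1) φ ^ (n + 1) - X (φ ^ (n +
1))'`, whose coefficient at `X ^ (n + 1)` cancels. -/
theorem coeff_pow_succ_mul_derivative_of_mul_eq_X {A : Type*} [CommRing A] [IsAddTorsionFree A]
    {φ h : PowerSeries A} (hφh : φ * h = X) (n : ℕ) :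
    coeff (n + 1) (φ ^ (n + 2) * derivative A h) = 0 := by
  have hD : φ * derivative A h + h * derivative A φ = 1 := by
    have := congrArg (derivative A) hφh
    rwa [Derivation.leibniz, derivative_X, smul_eq_mul, smul_eq_mul] at this
  have e : (n + 1) • (φ ^ (n + 2) * derivative A h) =
      (n + 1) • φ ^ (n + 1) - X * derivative A (φ ^ (n + 1)) := by
    rw [derivative_pow, ← hφh]
    have : derivative A h * φ = 1 - h * derivative A φ := by rw [← hD]; ring
    simp only [nsmul_eq_mul, Nat.add_sub_cancel]
    linear_combination (φ ^ (n + 1) * ((n + 1 : ℕ) : PowerSeries A)) * this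
  have h2 : (n + 1) • coeff (n + 1) (φ ^ (n + 2) * derivative A h) = 0 := by
    rw [← map_nsmul, e, map_sub, map_nsmul, coeff_succ_X_mul, coeff_derivative, nsmul_eq_mul]
    push_cast
    ring
  exact nsmul_right_injective (Nat.succ_ne_zero n) (h2.trans (nsmul_zero _).symm)

/-- Invariance of the residue of `G / x ^ (n + 1)` under the change of variable `x = h`. In the
induction the constant term of `G` contributes nothing by the previous lemma, and in the rest one
factor `φ * h` becomes `X`. -/
theorem coeff_pow_succ_mul_subst_mul_derivative {A : Type*} [CommRing A] [IsAddTorsionFree A]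
    {φ h : PowerSeries A} (hφh : φ * h = X) (hs : HasSubst h) (hφ : constantCoeff φ = 1)
    (h1 : constantCoeff (derivative A h) = 1) (n : ℕ) (G : PowerSeries A) :
    coeff n (φ ^ (n + 1) * (G.subst h * derivative A h)) = coeff n G := by
  have key : ∀ G : PowerSeries A, ∃ G' : PowerSeries A, G = C (constantCoeff G) + X * G' ∧
      ∀ n, coeff n G' = coeff (n + 1) G := by
    intro G
    refine ⟨mk fun n => coeff (n + 1) G, ?_, fun n => by simp⟩
    rw [add_comm]
    simpa [mul_comm] using eq_shift_mul_X_add_const G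
  induction n generalizing G with
  | zero =>
    obtain ⟨G', hG, -⟩ := key G
    have : G.subst h = C (constantCoeff G) + h * G'.subst h := by
      conv_lhs => rw [hG]
      rw [subst_add hs, subst_mul hs, subst_X hs, subst_C]
      rfl
    have hh : constantCoeff h = 0 := by
      have := congrArg constantCoeff hφh
      simpa [hφ] using this
    rw [this]
    simp [h1, hφ, hh]
  | succ n ih =>
    obtain ⟨G', hG, hG'⟩ := key G
    have : G.subst h = C (constantCoeff G) + h * G'.subst h := by
      conv_lhs => rw [hG]
      rw [subst_add hs, subst_mul hs, subst_X hs, subst_C]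
      rfl
    have e : φ ^ (n + 2) * (G.subst h * derivative A h) =
        C (constantCoeff G) * (φ ^ (n + 2) * derivative A h) +
        X * (φ ^ (n + 1) * (G'.subst h * derivative A h)) := by
      rw [this, ← hφh]; ring
    rw [e, map_add, coeff_C_mul, coeff_pow_succ_mul_derivative_of_mul_eq_X hφh, coeff_succ_X_mul,
      ih, hG']
    simp

/-- Lagrange inversion. -/
theorem eq_X_mul_subst_of_coeff_pow {A : Type*} [CommRing A] [IsAddTorsionFree A]
    {φ R : PowerSeries A} (hφ : constantCoeff φ = 1) (hR0 : constantCoeff R = 0)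
    (hR : ∀ n, (n + 1) • coeff (n + 1) R = coeff n (φ ^ (n + 1))) :
    R = X * φ.subst R := by
  let ψ := invOfUnit φ 1
  have hφψ : φ * ψ = 1 := mul_invOfUnit φ 1 (by simp [hφ])
  have hψ0 : constantCoeff ψ = 1 := by
    have := congrArg constantCoeff hφψ
    simpa [hφ] using this
  -- The equation `R = X * φ(R)` says that `R` is the compositional inverse of `h = X / φ`.
  let h := X * ψ
  have hφh : φ * h = X := by
    calc φ * h = X * (φ * ψ) := by ring
      _ = X := by rw [hφψ, mul_one]
  have hh0 : constantCoeff h = 0 := by simp [h]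
  have hh1 : coeff 1 h = 1 := by
    simp [h, hψ0]
  have hu : IsUnit (coeff 1 h) := by rw [hh1]; exact isUnit_one
  have hs : HasSubst h := HasSubst.of_constantCoeff_zero' hh0
  let S := h.substInvOfIsUnit hu
  have hS0 : constantCoeff S = 0 := by simp [S]
  have hSs : HasSubst S := HasSubst.of_constantCoeff_zero' hS0
  have hl : S.subst h = X := subst_substInvOfIsUnit_left h hh0 hu
  have hr : h.subst S = X := subst_substInvOfIsUnit_right h hh0 hu
  -- Taking `G = S'` in the residue lemma leaves `[x ^ n] φ ^ (n + 1)` alone on the left.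
  have hD : (derivative A S).subst h * derivative A h = 1 := by
    rw [← derivative_subst hs, hl, derivative_X]
  have hd1 : constantCoeff (derivative A h) = 1 := by
    rw [← coeff_zero_eq_constantCoeff_apply, coeff_derivative]
    simp [hh1]
  have hRS : R = S := by
    ext n
    cases n with
    | zero => simp [hR0, hS0]
    | succ n =>
      have e := coeff_pow_succ_mul_subst_mul_derivative hφh hs hφ hd1 n (derivative A S)
      rw [hD, mul_one, ← hR, coeff_derivative] at e
      have : (n + 1) • coeff (n + 1) R = (n + 1) • coeff (n + 1) S := by
        rw [e, nsmul_eq_mul]; push_cast; ring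
      exact nsmul_right_injective (Nat.succ_ne_zero n) this
  have h1 : φ.subst S * h.subst S = S := by
    rw [← subst_mul hSs, hφh, subst_X hSs]
  rw [hRS]
  calc S = φ.subst S * h.subst S := h1.symm
    _ = X * φ.subst S := by rw [hr, mul_comm]

end PowerSeries

/-! ### Coefficients of the powers of `exp (edgeSeries)`. -/

instance isAddTorsionFree_edgeRing : IsAddTorsionFree EdgeRing :=
  IsAddTorsionFree.of_module_rat _

/-- The total size `∑ (i - 1) * lam i` of the edges of a type, their first vertices not counted. -/
def edgeWeight (lam : ℕ →₀ ℕ) : ℕ := lam.sum fun i k => k * (i - 1)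

/-- The product `∏ (lam i)! * (i - 1)! ^ (lam i)`. -/
def edgeDenom (lam : ℕ →₀ ℕ) : ℕ := lam.prod fun i k => k.factorial * (i - 1).factorial ^ k

theorem edgeDenom_pos (lam : ℕ →₀ ℕ) : 0 < edgeDenom lam :=
  Finset.prod_pos fun _ _ => by positivity

theorem edgeDenom_add_single (lam : ℕ →₀ ℕ) (i : ℕ) :
    edgeDenom (lam + Finsupp.single i 1) = edgeDenom lam * (lam i + 1) * (i - 1).factorial := by
  have h (lam : ℕ →₀ ℕ) : edgeDenom lam =
      ((lam i).factorial * (i - 1).factorial ^ lam i) * edgeDenom (lam.erase i) :=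
    (Finsupp.mul_prod_erase' lam i (fun i k => k.factorial * (i - 1).factorial ^ k)
      (fun _ => by simp)).symm
  rw [h (lam + _), h lam]
  have : (lam + Finsupp.single i 1).erase i = lam.erase i := by simp
  rw [this]
  simp [Nat.factorial_succ, pow_succ]
  ring

theorem edgeWeight_add_single (lam : ℕ →₀ ℕ) (i : ℕ) :
    edgeWeight (lam + Finsupp.single i 1) = edgeWeight lam + (i - 1) := by
  unfold edgeWeight
  rw [Finsupp.sum_add_index' (by simp) (by intros; ring)]
  simp

/-- The series with coefficient `n ^ (∑ lam i) / ∏ (lam i)! * (i - 1)! ^ (lam i)` at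
`x ^ edgeWeight lam * ∏ (u i) ^ (lam i)`. -/
noncomputable def expEdgePow (n : ℕ) : PowerSeries EdgeRing :=
  PowerSeries.mk fun N => EdgeRing.ofCoeff fun lam =>
    if lam 0 = 0 ∧ lam 1 = 0 ∧ edgeWeight lam = N then (n : ℚ) ^ lam.degree / edgeDenom lam else 0

theorem coeff_expEdgePow (n N : ℕ) (lam : ℕ →₀ ℕ) :
    MvPowerSeries.coeff lam (PowerSeries.coeff N (expEdgePow n)) =
      if lam 0 = 0 ∧ lam 1 = 0 ∧ edgeWeight lam = N then (n : ℚ) ^ lam.degree / edgeDenom lam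
      else 0 := by
  rw [expEdgePow, PowerSeries.coeff_mk, EdgeRing.coeff_ofCoeff]

theorem edgeWeight_eq_sum_range {lam : ℕ →₀ ℕ} {N : ℕ} (h0 : lam 0 = 0)
    (h : edgeWeight lam = N + 1) :
    ∑ a ∈ Finset.range (N + 1), lam (a + 2) * (a + 1) = N + 1 := by
  refine Eq.trans ?_ h
  unfold edgeWeight
  rw [Finsupp.sum_of_support_subset (s := Finset.range (N + 3)) lam _ _ (by simp)]
  · rw [Finset.sum_range_succ' _ (N + 2), Finset.sum_range_succ' _ (N + 1)]
    simp [h0]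
  · intro i hi
    have h1 : lam i * (i - 1) ≤ edgeWeight lam :=
      Finset.single_le_sum (f := fun i => lam i * (i - 1)) (fun _ _ => Nat.zero_le _) hi
    have h2 : 1 * (i - 1) ≤ lam i * (i - 1) :=
      Nat.mul_le_mul_right _ (Nat.pos_of_ne_zero (Finsupp.mem_support_iff.1 hi))
    rw [Finset.mem_range]
    omega

/-- Removing one edge of size `a + 2` from `lam` multiplies `n ^ lam.degree / edgeDenom lam` by `lam
(a + 2) * (a + 1)! / n`. -/
theorem coeff_X_mul_expEdgePow (n a b : ℕ) (lam : ℕ →₀ ℕ) :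
    (n : ℚ) * ((a.factorial : ℚ)⁻¹ *
      MvPowerSeries.coeff lam (MvPowerSeries.X (a + 2) * PowerSeries.coeff b (expEdgePow n))) =
    MvPowerSeries.coeff lam (PowerSeries.coeff (a + b + 1) (expEdgePow n)) *
      (lam (a + 2) * (a + 1) : ℕ) := by
  by_cases hl : lam (a + 2) = 0
  · rw [MvPowerSeries.X_def, MvPowerSeries.coeff_monomial_mul, if_neg]
    · simp [hl]
    · rw [Finsupp.single_le_iff]; omega
  · obtain ⟨mu, rfl⟩ : ∃ mu, lam = mu + Finsupp.single (a + 2) 1 :=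
      ⟨lam - Finsupp.single (a + 2) 1,
        (tsub_add_cancel_of_le (Finsupp.single_le_iff.2 (by omega))).symm⟩
    rw [MvPowerSeries.X_def, add_comm mu, MvPowerSeries.coeff_add_monomial_mul, one_mul,
      add_comm _ mu, coeff_expEdgePow, coeff_expEdgePow, edgeWeight_add_single,
      edgeDenom_add_single]
    have e : (mu 0 = 0 ∧ mu 1 = 0 ∧ edgeWeight mu = b) ↔ ((mu + Finsupp.single (a + 2) 1 : ℕ →₀ ℕ) 0 = 0 ∧
        (mu + Finsupp.single (a + 2) 1 : ℕ →₀ ℕ) 1 = 0 ∧ edgeWeight mu + (a + 2 - 1) = a + b + 1) := by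
      have h0 : (mu + Finsupp.single (a + 2) 1 : ℕ →₀ ℕ) 0 = mu 0 := by simp
      have h1 : (mu + Finsupp.single (a + 2) 1 : ℕ →₀ ℕ) 1 = mu 1 := by simp
      rw [h0, h1]
      constructor <;> rintro ⟨h1, h2, h3⟩ <;> refine ⟨h1, h2, by omega⟩
    simp only [← e]
    split_ifs
    · have := (edgeDenom_pos mu).ne'
      have := a.factorial_ne_zero
      rw [map_add, Finsupp.degree_single, pow_succ]
      simp only [Finsupp.add_apply, Finsupp.single_eq_same, Nat.add_one_sub_one,
        Nat.factorial_succ]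
      push_cast
      field_simp
    · simp

theorem derivative_edgeSeries :
    PowerSeries.derivative EdgeRing edgeSeries = PowerSeries.mk fun a =>
      ((a.factorial : ℚ)⁻¹) • (MvPowerSeries.X (a + 2) : EdgeRing) := by
  ext1 a
  rw [PowerSeries.coeff_derivative, edgeSeries, PowerSeries.coeff_mk, PowerSeries.coeff_mk,
    if_neg (by omega), mul_comm, ← Nat.cast_add_one, ← nsmul_eq_mul, ← Nat.cast_smul_eq_nsmul ℚ,
    smul_smul, Nat.factorial_succ]
  congr 1
  push_cast
  field_simp

/-- Edges of size `a + 2` contribute the share `lam (a + 2) * (a + 1)` of the coefficient at `N +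
1`, and the shares add up to the edge weight `N + 1`, the factor that differentiation produces. -/
theorem derivative_expEdgePow (n : ℕ) :
    PowerSeries.derivative EdgeRing (expEdgePow n) =
      (n • PowerSeries.derivative EdgeRing edgeSeries) * expEdgePow n := by
  ext N lam
  rw [PowerSeries.coeff_derivative, smul_mul_assoc, map_nsmul, PowerSeries.coeff_mul,
    Finset.Nat.sum_antidiagonal_eq_sum_range_succ_mk, map_nsmul, map_sum, ← Nat.cast_add_one,
    mul_comm, ← nsmul_eq_mul, map_nsmul, nsmul_eq_mul, nsmul_eq_mul, Finset.mul_sum]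
  have h : ∀ a ∈ Finset.range N.succ, (n : ℚ) * MvPowerSeries.coeff lam
      (PowerSeries.coeff a (PowerSeries.derivative EdgeRing edgeSeries) *
        PowerSeries.coeff (N - a) (expEdgePow n)) =
      MvPowerSeries.coeff lam (PowerSeries.coeff (N + 1) (expEdgePow n)) *
      (lam (a + 2) * (a + 1) : ℕ) := by
    intro a ha
    have ha' : a + (N - a) = N := by have := Finset.mem_range.1 ha; omega
    rw [derivative_edgeSeries, PowerSeries.coeff_mk, smul_mul_assoc, MvPowerSeries.coeff_smul,
      coeff_X_mul_expEdgePow, ha']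
  rw [Finset.sum_congr rfl h, ← Finset.mul_sum, ← Nat.cast_sum, coeff_expEdgePow]
  split_ifs with hc
  · rw [edgeWeight_eq_sum_range hc.1 hc.2.2, mul_comm]
  · simp

theorem hasSubst_edgeSeries : PowerSeries.HasSubst edgeSeries :=
  PowerSeries.HasSubst.of_constantCoeff_zero' (by simp [edgeSeries])

theorem constantCoeff_expEdgePow (n : ℕ) : PowerSeries.constantCoeff (expEdgePow n) = 1 := by
  classical
  rw [← PowerSeries.coeff_zero_eq_constantCoeff_apply]
  ext lam
  rw [coeff_expEdgePow, MvPowerSeries.coeff_one]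
  have : (lam 0 = 0 ∧ lam 1 = 0 ∧ edgeWeight lam = 0) ↔ lam = 0 := by
    constructor
    · rintro ⟨h0, h1, h2⟩
      ext i
      have h2' := (Finset.sum_eq_zero_iff.1 h2) i
      by_contra hi
      have := h2' (Finsupp.mem_support_iff.2 hi)
      rcases i with _ | _ | i
      · exact hi h0
      · exact hi h1
      · rcases Nat.mul_eq_zero.1 this with h | h
        · exact hi h
        · omega
    · rintro rfl
      simp [edgeWeight]
  simp only [this]
  split_ifs with h
  · simp [h, edgeDenom]
  · rfl

theorem constantCoeff_exp_subst_edgeSeries :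
    PowerSeries.constantCoeff
      ((PowerSeries.exp EdgeRing).subst edgeSeries : PowerSeries EdgeRing) = 1 := by
  rw [← PowerSeries.coeff_zero_eq_constantCoeff_apply,
    PowerSeries.coeff_subst' hasSubst_edgeSeries, finsum_eq_single _ 0]
  · simp
  · intro d hd
    simp [edgeSeries, hd]

/-- Both sides have constant term 1 and solve `F' = n * edgeSeries' * F`. -/
theorem exp_subst_edgeSeries_pow (n : ℕ) :
    ((PowerSeries.exp EdgeRing).subst edgeSeries : PowerSeries EdgeRing) ^ n = expEdgePow n := by
  refine PowerSeries.eq_of_derivative_eq_mul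
    (c := n • PowerSeries.derivative EdgeRing edgeSeries) ?_ (derivative_expEdgePow n) ?_
  · rw [PowerSeries.derivative_pow, PowerSeries.derivative_subst hasSubst_edgeSeries,
      PowerSeries.derivative_exp]
    cases n with
    | zero => simp
    | succ n =>
      rw [nsmul_eq_mul, Nat.add_sub_cancel]
      ring
  · rw [map_pow, constantCoeff_exp_subst_edgeSeries, one_pow, constantCoeff_expEdgePow]

/-! ### Counting rooted forests. -/

/-- Pairwise disjoint sets `B e` of vertices, of which `p e` is the parent, such that no vertex is
its own ancestor: the rank `d` decreases from the vertices of `B e` to `p e`. -/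
def IsRootedForest {V E : Type*} (B : E → Finset V) (p : E → V) : Prop :=
  (∀ e f, e ≠ f → Disjoint (B e) (B f)) ∧ ∃ d : V → ℕ, ∀ e, ∀ v ∈ B e, d (p e) < d v

theorem IsRootedForest.eq_of_mem {V E : Type*} {B : E → Finset V} {p : E → V}
    (h : IsRootedForest B p) {v : V} {e f : E} (he : v ∈ B e) (hf : v ∈ B f) : e = f := by
  by_contra hne
  exact Finset.disjoint_left.1 (h.1 e f hne) he hf

/-- `ρ` sends a vertex to the root of its component. -/
structure IsRootMap {V E : Type*} (B : E → Finset V) (p : E → V) (ρ : V → V) : Prop where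
  notMem : ∀ v e, ρ v ∉ B e
  eq_self : ∀ v, (∀ e, v ∉ B e) → ρ v = v
  eq_parent : ∀ e, ∀ v ∈ B e, ρ v = ρ (p e)
  -- Required for every rank function, since it gets applied to one coming from a larger forest.
  rank_le : ∀ d : V → ℕ, (∀ e, ∀ v ∈ B e, d (p e) < d v) → ∀ v, d (ρ v) ≤ d v

/-- Passing to the parent lowers the rank until a root is reached, and roots are fixed, so a large
iterate of the parent map is a root map. -/
theorem IsRootedForest.exists_isRootMap {V E : Type*} [Finite V] {B : E → Finset V} {p : E → V}
    (h : IsRootedForest B p) : ∃ ρ : V → V, IsRootMap B p ρ := by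
  classical
  have := Fintype.ofFinite V
  let par : V → V := fun v => if hv : ∃ e, v ∈ B e then p hv.choose else v
  have par_mem {v : V} {e : E} (hv : v ∈ B e) : par v = p e := by
    have hv' : ∃ e, v ∈ B e := ⟨e, hv⟩
    simp only [par, dif_pos hv']
    rw [h.eq_of_mem hv'.choose_spec hv]
  have par_root {v : V} (hv : ∀ e, v ∉ B e) : par v = v := by
    have hv' : ¬ ∃ e, v ∈ B e := by simpa using hv
    simp only [par, dif_neg hv']
  have par_le (d : V → ℕ) (hd : ∀ e, ∀ v ∈ B e, d (p e) < d v) (v : V) : d (par v) ≤ d v := by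
    by_cases hv : ∃ e, v ∈ B e
    · obtain ⟨e, hv⟩ := hv
      rw [par_mem hv]
      exact (hd e v hv).le
    · rw [par_root (by simpa using hv)]
  have iter_root {v : V} (hv : ∀ e, v ∉ B e) (k : ℕ) : par^[k] v = v :=
    Function.iterate_fixed (par_root hv) k
  obtain ⟨d, hd⟩ := h.2
  have step (k : ℕ) (v : V) : (∀ e, par^[k] v ∉ B e) ∨ d (par^[k] v) + k ≤ d v := by
    induction k generalizing v with
    | zero => exact Or.inr le_rfl
    | succ k ih =>
      rw [Function.iterate_succ_apply]
      by_cases hv : ∃ e, v ∈ B e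
      · obtain ⟨e, hv⟩ := hv
        have := hd e v hv
        rw [par_mem hv]
        refine (ih (p e)).imp id fun h => by omega
      · have hv' : ∀ e, v ∉ B e := by simpa using hv
        rw [par_root hv', iter_root hv']
        exact Or.inl hv'
  let N := ∑ v, d v + 1
  have hN (v : V) : ∀ e, par^[N] v ∉ B e := by
    have : d v ≤ ∑ v, d v := Finset.single_le_sum (fun _ _ => Nat.zero_le _) (Finset.mem_univ v)
    exact (step N v).resolve_right (by omega)
  refine ⟨par^[N], hN, fun v hv => iter_root hv N, fun e v hv => ?_, fun d hd v => ?_⟩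
  · rw [← par_mem hv, ← Function.iterate_succ_apply par N, Function.iterate_succ_apply' par N, par_root (hN v)]
  · generalize N = k
    induction k with
    | zero => exact le_rfl
    | succ k ih =>
      rw [Function.iterate_succ_apply']
      exact (par_le d hd _).trans ih

/-- An added edge whose children are roots creates a cycle of ancestors exactly when its parent lies
in the component of one of these children. -/
theorem isRootedForest_option_iff {V E : Type*} {B : Option E → Finset V} {p : Option E → V}
    (h : IsRootedForest (fun e => B (some e)) (fun e => p (some e))) {ρ : V → V}
    (hρ : IsRootMap (fun e => B (some e)) (fun e => p (some e)) ρ) :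
    IsRootedForest B p ↔ (∀ v ∈ B none, ∀ e, v ∉ B (some e)) ∧ ρ (p none) ∉ B none := by
  classical
  constructor
  · rintro ⟨hB, d, hd⟩
    refine ⟨fun v hv e he => Finset.disjoint_left.1 (hB none (some e) (by simp)) hv he,
      fun hp => ?_⟩
    exact absurd (hd none _ hp) (not_lt.2 (hρ.rank_le d (fun e => hd (some e)) (p none)))
  · rintro ⟨hB, hp⟩
    obtain ⟨d, hd⟩ := h.2
    -- Components whose root becomes a child are lifted as a whole above the new parent, so the old
    -- inequalities persist.
    refine ⟨?_, fun v => d v + if ρ v ∈ B none then d (p none) + 1 else 0, ?_⟩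
    · rintro (_ | e) (_ | f) hne
      · exact absurd rfl hne
      · exact Finset.disjoint_left.2 fun v hv => hB v hv f
      · exact Finset.disjoint_right.2 fun v hv => hB v hv e
      · exact h.1 e f fun h => hne (by rw [h])
    · rintro (_ | e) v hv
      · have : ρ v ∈ B none := by rwa [hρ.eq_self v (hB v hv)]
        simp only [if_neg hp, if_pos this]
        omega
      · have : d (p (some e)) < d v := hd e v hv
        simp only [hρ.eq_parent e v hv]
        omega

theorem IsRootedForest.of_option {V E : Type*} {B : Option E → Finset V} {p : Option E → V}
    (h : IsRootedForest B p) : IsRootedForest (fun e => B (some e)) (fun e => p (some e)) :=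
  ⟨fun e f hne => h.1 _ _ (by simpa using hne), h.2.imp fun _ hd e => hd (some e)⟩

/-- Rooted forests with prescribed sizes of the sets of siblings. -/
abbrev RootedForest (V : Type*) {E : Type*} (s : E → ℕ) : Type _ :=
  {x : (E → Finset V) × (E → V) // IsRootedForest x.1 x.2 ∧ ∀ e, (x.1 e).card = s e}

/-- The vertices that are nobody's children. -/
def rootSet {V E : Type*} [Fintype V] [DecidableEq V] [Fintype E] (B : E → Finset V) : Finset V :=
  (Finset.univ.biUnion B)ᶜ

theorem mem_rootSet {V E : Type*} [Fintype V] [DecidableEq V] [Fintype E] {B : E → Finset V}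
    {v : V} : v ∈ rootSet B ↔ ∀ e, v ∉ B e := by
  simp [rootSet]

theorem RootedForest.card_rootSet {V E : Type*} [Fintype V] [DecidableEq V] [Fintype E]
    {s : E → ℕ} (F : RootedForest V s) : (rootSet F.1.1).card = Fintype.card V - ∑ e, s e := by
  rw [rootSet, Finset.card_compl, Finset.card_biUnion fun e _ f _ h => F.2.1.1 e f h]
  simp only [F.2.2]

/-- A root map of a rooted forest. -/
noncomputable def RootedForest.rootMap {V E : Type*} [Finite V] {s : E → ℕ}
    (F : RootedForest V s) : V → V :=
  F.2.1.exists_isRootMap.choose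

theorem RootedForest.isRootMap {V E : Type*} [Finite V] {s : E → ℕ} (F : RootedForest V s) :
    IsRootMap F.1.1 F.1.2 F.rootMap :=
  F.2.1.exists_isRootMap.choose_spec

/-- A rooted forest with one more edge: the parent is any vertex, the children are roots of other
components. -/
noncomputable def RootedForest.optionEquiv (V : Type*) {E : Type*} [Fintype V] [DecidableEq V]
    [Fintype E] (s : Option E → ℕ) :
    RootedForest V s ≃ Σ F : RootedForest V fun e => s (some e), Σ v : V,
      {b : Finset V // b ∈ ((rootSet F.1.1).erase (F.rootMap v)).powersetCard (s none)} where
  toFun x := ⟨⟨(fun e => x.1.1 (some e), fun e => x.1.2 (some e)), x.2.1.of_option,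
      fun e => x.2.2 (some e)⟩, x.1.2 none, x.1.1 none, by
    have h := (isRootedForest_option_iff x.2.1.of_option (RootedForest.isRootMap
      (⟨(fun e => x.1.1 (some e), fun e => x.1.2 (some e)), x.2.1.of_option,
        fun e => x.2.2 (some e)⟩ : RootedForest V fun e => s (some e)))).1 x.2.1
    rw [Finset.mem_powersetCard]
    refine ⟨fun v hv => Finset.mem_erase.2 ⟨?_, mem_rootSet.2 (h.1 v hv)⟩, x.2.2 none⟩
    rintro rfl
    exact h.2 hv⟩
  invFun y := ⟨(fun e => e.elim y.2.2.1 y.1.1.1, fun e => e.elim y.2.1 y.1.1.2), by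
    obtain ⟨F, v, b, hb⟩ := y
    rw [Finset.mem_powersetCard] at hb
    refine ⟨(isRootedForest_option_iff (B := fun e => e.elim b F.1.1)
      (p := fun e => e.elim v F.1.2) F.2.1 F.isRootMap).2 ⟨fun w hw => ?_, fun h => ?_⟩, ?_⟩
    · exact mem_rootSet.1 (Finset.mem_of_mem_erase (hb.1 hw))
    · exact Finset.notMem_erase _ _ (hb.1 h)
    · rintro (_ | e)
      · exact hb.2
      · exact F.2.2 e⟩
  left_inv x := by
    apply Subtype.ext
    apply Prod.ext <;> funext e <;> cases e <;> rfl
  right_inv y := rfl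

/-- Every forest has as many roots as vertices that are not children, and exactly one of them, the
root above the new parent, is forbidden. -/
theorem RootedForest.card_option (V : Type*) {E : Type*} [Fintype V] [Fintype E]
    (s : Option E → ℕ) :
    Nat.card (RootedForest V s) = Nat.card (RootedForest V fun e => s (some e)) *
      (Fintype.card V * (Fintype.card V - 1 - ∑ e, s (some e)).choose (s none)) := by
  classical
  have := Fintype.ofFinite (RootedForest V fun e => s (some e))
  rw [Nat.card_congr (RootedForest.optionEquiv V s), Nat.card_sigma]
  have h (F : RootedForest V fun e => s (some e)) (v : V) : Nat.card {b : Finset V //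
      b ∈ ((rootSet F.1.1).erase (F.rootMap v)).powersetCard (s none)} =
      (Fintype.card V - 1 - ∑ e, s (some e)).choose (s none) := by
    rw [Nat.card_eq_fintype_card, Fintype.card_coe, Finset.card_powersetCard,
      Finset.card_erase_of_mem (mem_rootSet.2 (F.isRootMap.notMem v)), F.card_rootSet,
      Nat.sub_right_comm]
  have h' (F : RootedForest V fun e => s (some e)) : Nat.card (Σ v : V, {b : Finset V //
      b ∈ ((rootSet F.1.1).erase (F.rootMap v)).powersetCard (s none)}) =
      Fintype.card V * (Fintype.card V - 1 - ∑ e, s (some e)).choose (s none) := by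
    rw [Nat.card_sigma, Finset.sum_congr rfl fun v _ => h F v, Finset.sum_const, Finset.card_univ,
      smul_eq_mul]
  rw [Finset.sum_congr rfl fun F _ => h' F, Finset.sum_const, Finset.card_univ, smul_eq_mul,
    Nat.card_eq_fintype_card]

theorem RootedForest.card_equiv (V : Type*) {E F : Type*} (f : E ≃ F) (s : F → ℕ) :
    Nat.card (RootedForest V s) = Nat.card (RootedForest V fun e => s (f e)) := by
  refine (Nat.card_congr (Equiv.subtypeEquiv
    ((Equiv.arrowCongr f (Equiv.refl (Finset V))).prodCongr
      (Equiv.arrowCongr f (Equiv.refl V))) ?_)).symm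
  rintro ⟨B, p⟩
  have h1 : IsRootedForest (fun x => B (f.symm x)) (fun x => p (f.symm x)) ↔
      IsRootedForest B p := by
    constructor
    · rintro ⟨h1, d, hd⟩
      refine ⟨fun e e' h => ?_, d, fun e => ?_⟩
      · simpa using h1 (f e) (f e') (by simpa using h)
      · simpa using hd (f e)
    · rintro ⟨h1, d, hd⟩
      exact ⟨fun e e' h => h1 _ _ (by simpa using h), d, fun e => hd _⟩
  have h2 : (∀ x, (B (f.symm x)).card = s x) ↔ ∀ e, (B e).card = s (f e) :=
    ⟨fun h e => by simpa using h (f e), fun h x => by simpa using h (f.symm x)⟩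
  exact and_congr h1.symm h2.symm

theorem RootedForest.card_mul_prod_factorial (V : Type*) [Fintype V] (E : Type*) [Fintype E]
    (s : E → ℕ) :
    Nat.card (RootedForest V s) * ∏ e, (s e).factorial =
      Fintype.card V ^ Fintype.card E * (Fintype.card V - 1).descFactorial (∑ e, s e) := by
  revert s
  refine Fintype.induction_empty_option (P := fun E _ => ∀ s : E → ℕ,
    Nat.card (RootedForest V s) * ∏ e, (s e).factorial =
      Fintype.card V ^ Fintype.card E * (Fintype.card V - 1).descFactorial (∑ e, s e))
    ?_ ?_ ?_ E
  · intro E F _ f ih s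
    let := Fintype.ofEquiv F f.symm
    rw [RootedForest.card_equiv V f, ← Equiv.prod_comp f, ← Equiv.sum_comp f,
      ← Fintype.card_congr f]
    convert ih fun e => s (f e)
  · intro s
    have : Unique (RootedForest V s) :=
      { default := ⟨(PEmpty.elim, PEmpty.elim), ⟨fun e => e.elim, 0, fun e => e.elim⟩,
          fun e => e.elim⟩
        uniq := fun x => Subtype.ext (Prod.ext (funext fun e => e.elim) (funext fun e => e.elim)) }
    simp
  · intro E _ ih s
    rw [RootedForest.card_option, Fintype.prod_option, Fintype.sum_option, Fintype.card_option,
      ← Nat.descFactorial_mul_descFactorial (Nat.le_add_left (∑ e, s (some e)) (s none)),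
      Nat.add_sub_cancel, pow_succ]
    have := ih fun e => s (some e)
    rw [Nat.descFactorial_eq_factorial_mul_choose _ (s none)]
    linear_combination (Fintype.card V * (Fintype.card V - 1 - ∑ e, s (some e)).choose (s none) *
      (s none).factorial) * this

/-! ### Distances from a root in trees and connected graphs. -/

namespace SimpleGraph

/-- A neighbor of `a` closer to `u` must be the penultimate vertex of the path from `u` to `a`. -/
theorem IsTree.eq_of_adj_of_dist_lt {V : Type*} {G : SimpleGraph V} (hG : G.IsTree) {u a b b' : V}
    (hb : G.Adj a b) (hb' : G.Adj a b') (hd : G.dist u b < G.dist u a)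
    (hd' : G.dist u b' < G.dist u a) : b = b' := by
  obtain ⟨p, hp, hpl⟩ := hG.connected.exists_path_of_dist u a
  have h {b : V} (hb : G.Adj a b) (hd : G.dist u b < G.dist u a) : b = p.penultimate := by
    obtain ⟨q, hq, hql⟩ := hG.connected.exists_path_of_dist u b
    refine hG.isAcyclic.eq_penultimate_of_adj_end hp hb ?_
    refine hG.isAcyclic.mem_support_of_ne_mem_support_of_adj_of_isPath hp hq hb fun ha => ?_
    have := congrArg Walk.length (hG.isAcyclic.path_concat hp hq hb ha)
    rw [Walk.length_concat] at this
    omega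
  rw [h hb hd, h hb' hd']

theorem Connected.exists_adj_dist_lt {V : Type*} {G : SimpleGraph V} (hG : G.Connected) {u a : V}
    (ha : u ≠ a) : ∃ b, G.Adj a b ∧ G.dist u b < G.dist u a := by
  obtain ⟨p, hp⟩ := hG.exists_walk_length_eq_dist u a
  have hnil : ¬ p.Nil := Walk.not_nil_of_ne ha
  refine ⟨p.penultimate, (p.adj_penultimate hnil).symm, ?_⟩
  have h1 := dist_le p.dropLast
  have h2 := p.length_dropLast_add_one hnil
  omega

end SimpleGraph

/-! ### Hypertrees through their incidence graphs. -/

namespace MultiHypergraph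

variable {V E : Type*}

/-- The bipartite graph of incidences between vertices and edges. -/
def incidenceGraph (H : MultiHypergraph V E) : SimpleGraph (V ⊕ E) where
  Adj
    | .inl v, .inr e => v ∈ H.verts e
    | .inr e, .inl v => v ∈ H.verts e
    | _, _ => False
  symm := ⟨by rintro (v | e) (w | f) h <;> exact h⟩
  loopless := ⟨by rintro (v | e) h <;> exact h⟩

theorem incidenceGraph_adj {H : MultiHypergraph V E} {v : V} {e : E} :
    H.incidenceGraph.Adj (.inl v) (.inr e) ↔ v ∈ H.verts e := Iff.rfl

theorem incidenceGraph_adj' {H : MultiHypergraph V E} {v : V} {e : E} :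
    H.incidenceGraph.Adj (.inr e) (.inl v) ↔ v ∈ H.verts e := Iff.rfl

theorem exists_inr_of_adj_inl {H : MultiHypergraph V E} {v : V} {b : V ⊕ E}
    (h : H.incidenceGraph.Adj (.inl v) b) : ∃ e, b = .inr e := by
  rcases b with w | e
  · exact h.elim
  · exact ⟨e, rfl⟩

theorem exists_inl_of_adj_inr {H : MultiHypergraph V E} {e : E} {b : V ⊕ E}
    (h : H.incidenceGraph.Adj (.inr e) b) : ∃ v, b = .inl v := by
  rcases b with v | f
  · exact ⟨v, rfl⟩
  · exact h.elim

theorem getVert_even_odd {H : MultiHypergraph V E} {x : V} {b : V ⊕ E}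
    (c : H.incidenceGraph.Walk (.inl x) b) (i : ℕ) :
    (2 * i ≤ c.length → ∃ v, c.getVert (2 * i) = .inl v) ∧
      (2 * i + 1 ≤ c.length → ∃ e, c.getVert (2 * i + 1) = .inr e) := by
  have odd {i : ℕ} (hv : ∃ v, c.getVert (2 * i) = .inl v) (hi : 2 * i + 1 ≤ c.length) :
      ∃ e, c.getVert (2 * i + 1) = .inr e := by
    obtain ⟨v, hv⟩ := hv
    have := c.adj_getVert_succ (i := 2 * i) (by omega)
    rw [hv] at this
    exact exists_inr_of_adj_inl this
  induction i with
  | zero =>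
    have h0 : ∃ v, c.getVert (2 * 0) = .inl v := ⟨x, by simp⟩
    exact ⟨fun _ => h0, odd h0⟩
  | succ i ih =>
    have h : 2 * (i + 1) ≤ c.length → ∃ v, c.getVert (2 * (i + 1)) = .inl v := fun hi => by
      obtain ⟨e, he⟩ := ih.2 (by omega)
      have := c.adj_getVert_succ (i := 2 * i + 1) (by omega)
      rw [he] at this
      exact exists_inl_of_adj_inr this
    exact ⟨h, fun hi => odd (h (by omega)) hi⟩

/-- A walk between vertices in the incidence graph is a walk in the hypergraph. -/
theorem exists_isWalk_of_walk {H : MultiHypergraph V E} {x y : V}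
    (c : H.incidenceGraph.Walk (.inl x) (.inl y)) :
    ∃ (m : ℕ) (v : Fin (m + 1) → V) (e : Fin m → E), c.length = 2 * m ∧
      (∀ i : Fin (m + 1), c.getVert (2 * i) = .inl (v i)) ∧
      (∀ i : Fin m, c.getVert (2 * i + 1) = .inr (e i)) ∧
      H.IsWalk v e ∧ v 0 = x ∧ v (Fin.last m) = y := by
  obtain ⟨m, hm⟩ : ∃ m, c.length = 2 * m := by
    rcases Nat.even_or_odd' c.length with ⟨m, hm | hm⟩
    · exact ⟨m, hm⟩
    · obtain ⟨e, he⟩ := (getVert_even_odd c m).2 hm.ge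
      rw [← hm, c.getVert_length] at he
      cases he
  choose v hv using fun i : Fin (m + 1) => (getVert_even_odd c i).1 (by omega)
  choose e he using fun i : Fin m => (getVert_even_odd c i).2 (by omega)
  refine ⟨m, v, e, hm, hv, he, fun i => ?_, ?_, ?_⟩
  · have h1 := c.adj_getVert_succ (i := 2 * i) (by omega)
    have h2 := c.adj_getVert_succ (i := 2 * i + 1) (by omega)
    have h3 := hv i.castSucc
    have h4 := hv i.succ
    rw [Fin.val_castSucc] at h3
    rw [Fin.val_succ, mul_add, mul_one] at h4
    rw [h3, he] at h1
    rw [he, h4] at h2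
    exact ⟨h1, h2⟩
  · have := hv 0
    simp only [Fin.val_zero, mul_zero, SimpleGraph.Walk.getVert_zero] at this
    exact (Sum.inl_injective this).symm
  · have := hv (Fin.last m)
    rw [Fin.val_last, ← hm, SimpleGraph.Walk.getVert_length] at this
    exact (Sum.inl_injective this).symm

theorem isConnected_of_reachable {H : MultiHypergraph V E}
    (h : ∀ x y : V, H.incidenceGraph.Reachable (.inl x) (.inl y)) : H.IsConnected := by
  intro x y
  obtain ⟨c, hc⟩ := (h x y).exists_isPath
  obtain ⟨m, v, e, hm, hv, he, hw, hx, hy⟩ := exists_isWalk_of_walk c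
  refine ⟨m, v, e, ⟨hw, fun i j hij => ?_, fun i j hij => ?_⟩, hx, hy⟩
  · have := hc.getVert_injOn (x₁ := 2 * i) (x₂ := 2 * j)
      (show 2 * (i : ℕ) ≤ c.length by omega) (show 2 * (j : ℕ) ≤ c.length by omega)
      (by rw [hv, hv, hij])
    omega
  · have := hc.getVert_injOn (x₁ := 2 * i + 1) (x₂ := 2 * j + 1)
      (show 2 * (i : ℕ) + 1 ≤ c.length by omega) (show 2 * (j : ℕ) + 1 ≤ c.length by omega)
      (by rw [he, he, hij])
    omega

/-- A graph cycle based at a vertex has even length `2 * m ≥ 3`, so `m ≥ 2` and it is a hypergraph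
cycle. A cycle based at an edge is rotated first. -/
theorem IsHypertree.incidenceGraph_isAcyclic {H : MultiHypergraph V E} (hH : H.IsHypertree) :
    H.incidenceGraph.IsAcyclic := by
  classical
  have key {x : V} (c : H.incidenceGraph.Walk (.inl x) (.inl x)) : ¬ c.IsCycle := by
    intro hc
    obtain ⟨m, v, e, hm, hv, he, hw, hx, hy⟩ := exists_isWalk_of_walk c
    have h3 := hc.three_le_length
    refine hH.2 m v e ⟨hw, by omega, fun i j hij => ?_, hx.trans hy.symm, fun i j hij => ?_⟩
    · have := hc.getVert_injOn (x₁ := 2 * i + 1) (x₂ := 2 * j + 1)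
        (show 1 ≤ 2 * (i : ℕ) + 1 ∧ 2 * (i : ℕ) + 1 ≤ c.length by omega)
        (show 1 ≤ 2 * (j : ℕ) + 1 ∧ 2 * (j : ℕ) + 1 ≤ c.length by omega)
        (by rw [he, he, hij])
      omega
    · have h1 := hv i.castSucc
      have h2 := hv j.castSucc
      rw [Fin.val_castSucc] at h1 h2
      have := hc.getVert_injOn' (x₁ := 2 * i) (x₂ := 2 * j)
        (show 2 * (i : ℕ) ≤ c.length - 1 by omega) (show 2 * (j : ℕ) ≤ c.length - 1 by omega)
        (by rw [h1, h2]; exact congrArg _ hij)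
      omega
  rintro (x | e) c hc
  · exact key c hc
  · have := c.adj_snd hc.not_nil
    obtain ⟨x, hx⟩ := exists_inl_of_adj_inr this
    have hs : (Sum.inl x : V ⊕ E) ∈ c.support := by
      rw [← hx]; exact c.getVert_mem_support 1
    exact key (c.rotate _ hs) (hc.rotate hs)

theorem IsHypertree.incidenceGraph_isTree [Nonempty V] {H : MultiHypergraph V E}
    (hH : H.IsHypertree) : H.incidenceGraph.IsTree := by
  refine ⟨?_, hH.incidenceGraph_isAcyclic⟩
  have hv (x y : V) : H.incidenceGraph.Reachable (.inl x) (.inl y) := by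
    obtain ⟨m, v, e, ⟨hw, -⟩, rfl, rfl⟩ := hH.1 x y
    have (i : Fin (m + 1)) : H.incidenceGraph.Reachable (.inl (v 0)) (.inl (v i)) := by
      induction i using Fin.induction with
      | zero => rfl
      | succ i ih =>
        exact (ih.trans (SimpleGraph.Adj.reachable (incidenceGraph_adj.2 (hw i).1))).trans
          (SimpleGraph.Adj.reachable (incidenceGraph_adj'.2 (hw i).2))
    exact this _
  obtain ⟨x⟩ := ‹Nonempty V›
  rw [SimpleGraph.connected_iff_exists_forall_reachable]
  refine ⟨.inl x, ?_⟩
  rintro (y | e)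
  · exact hv x y
  · obtain ⟨y, hy⟩ := Finset.card_pos.1 (lt_of_lt_of_le two_pos (H.two_le_card e))
    exact (hv x y).trans (SimpleGraph.Adj.reachable (incidenceGraph_adj.2 hy))

/-- Rooting a hypertree at `r` makes it a rooted forest with the only root `r`. -/
theorem IsHypertree.exists_isRootedForest [DecidableEq V] {H : MultiHypergraph V E}
    (hH : H.IsHypertree) (r : V) :
    ∃ (B : E → Finset V) (p : E → V), IsRootedForest B p ∧ (∀ v, v = r ↔ ∀ e, v ∉ B e) ∧
      (∀ e, p e ∉ B e) ∧ ∀ e, H.verts e = insert (p e) (B e) := by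
  have : Nonempty V := ⟨r⟩
  have hT := hH.incidenceGraph_isTree
  let d := H.incidenceGraph.dist (.inl r)
  have hp (e : E) : ∃ v, v ∈ H.verts e ∧ d (.inl v) < d (.inr e) := by
    obtain ⟨b, hb, hd⟩ := hT.connected.exists_adj_dist_lt (u := .inl r) (a := .inr e) (by simp)
    obtain ⟨v, rfl⟩ := exists_inl_of_adj_inr hb
    exact ⟨v, hb, hd⟩
  choose p hpe hpd using hp
  -- In a tree an edge node has only one neighbor nearer to `r`, and adjacent nodes have different
  -- distances.
  have hB {e : E} {v : V} (hv : v ∈ (H.verts e).erase (p e)) : d (.inr e) < d (.inl v) := by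
    rw [Finset.mem_erase] at hv
    refine lt_of_not_ge fun hle => hv.1 ?_
    have hne := hT.dist_ne_of_adj (.inl r) (incidenceGraph_adj.2 hv.2)
    exact Sum.inl_injective (hT.eq_of_adj_of_dist_lt (u := .inl r) (incidenceGraph_adj'.2 hv.2)
      (incidenceGraph_adj'.2 (hpe e)) (lt_of_le_of_ne hle hne) (hpd e))
  refine ⟨fun e => (H.verts e).erase (p e), p, ⟨fun e f hne => ?_, fun v => d (.inl v),
    fun e v hv => (hpd e).trans (hB hv)⟩, fun v => ⟨?_, fun hv => ?_⟩,
    fun e => Finset.notMem_erase _ _, fun e => (Finset.insert_erase (hpe e)).symm⟩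
  -- Both `e` and `f` would be neighbors of `v` nearer to `r`.
  · refine Finset.disjoint_left.2 fun v he hf => hne ?_
    exact Sum.inr_injective (hT.eq_of_adj_of_dist_lt (u := .inl r)
      (incidenceGraph_adj.2 (Finset.mem_of_mem_erase he))
      (incidenceGraph_adj.2 (Finset.mem_of_mem_erase hf)) (hB he) (hB hf))
  · rintro rfl e hv
    have := hB hv
    simp [d] at this
  · by_contra hne
    obtain ⟨b, hb, hd⟩ := hT.connected.exists_adj_dist_lt (u := .inl r) (a := .inl v)
      (fun h => hne (Sum.inl_injective h).symm)
    obtain ⟨e, rfl⟩ := exists_inr_of_adj_inl hb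
    refine hv e (Finset.mem_erase.2 ⟨?_, hb⟩)
    rintro rfl
    exact lt_asymm hd (hpd e)

end MultiHypergraph

/-! ### Rooted hypertrees as rooted forests with one root. -/

theorem IsRootedForest.parent_notMem {V E : Type*} {B : E → Finset V} {p : E → V}
    (h : IsRootedForest B p) (e : E) : p e ∉ B e := by
  obtain ⟨d, hd⟩ := h.2
  exact fun he => lt_irrefl _ (hd e _ he)

/-- Parents lead down to `r`, which gives connectedness. On a cycle, a vertex of maximal rank cannot
be the parent in either of its two cycle edges, so it is a child in both, against disjointness. -/
theorem IsRootedForest.isHypertree {V E : Type*} [DecidableEq V] {B : E → Finset V} {p : E → V}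
    (h : IsRootedForest B p) {r : V} (hr : ∀ v, v = r ↔ ∀ e, v ∉ B e) {H : MultiHypergraph V E}
    (hH : ∀ e, H.verts e = insert (p e) (B e)) : H.IsHypertree := by
  obtain ⟨d, hd⟩ := h.2
  constructor
  · have key (n : ℕ) : ∀ v, d v = n → H.incidenceGraph.Reachable (.inl v) (.inl r) := by
      induction n using Nat.strong_induction_on with
      | _ n ih =>
        rintro v rfl
        by_cases hv : ∃ e, v ∈ B e
        · obtain ⟨e, hv⟩ := hv
          have h1 : v ∈ H.verts e := by rw [hH]; exact Finset.mem_insert_of_mem hv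
          have h2 : p e ∈ H.verts e := by rw [hH]; exact Finset.mem_insert_self _ _
          exact ((SimpleGraph.Adj.reachable (MultiHypergraph.incidenceGraph_adj.2 h1)).trans
            (SimpleGraph.Adj.reachable (MultiHypergraph.incidenceGraph_adj'.2 h2))).trans
            (ih _ (hd e v hv) _ rfl)
        · rw [(hr v).2 (by simpa using hv)]
    exact MultiHypergraph.isConnected_of_reachable fun x y =>
      (key _ x rfl).trans (key _ y rfl).symm
  · rintro m v e ⟨hw, hm, he, hv0, hv⟩
    have : NeZero m := ⟨by omega⟩
    obtain ⟨i, -, hi⟩ := Finset.exists_max_image (Finset.univ : Finset (Fin m))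
      (fun i => d (v i.castSucc)) Finset.univ_nonempty
    have mem {j k : Fin m} (ha : v i.castSucc ∈ H.verts (e j)) (hk : v k.castSucc ∈ H.verts (e j))
        (hne : k ≠ i) : v i.castSucc ∈ B (e j) := by
      rw [hH, Finset.mem_insert] at ha hk
      refine ha.resolve_left fun ha' => ?_
      have hk' := hk.resolve_left fun hk' => hne (hv (hk'.trans ha'.symm))
      have h1 := hd _ _ hk'
      have h2 := hi k (Finset.mem_univ k)
      rw [← ha'] at h1
      omega
    have h1 : v i.castSucc ∈ B (e i) := by
      by_cases hlast : (i : ℕ) + 1 < m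
      · exact mem (k := ⟨i + 1, hlast⟩) (hw i).1 (hw i).2 fun h => by
          have := congrArg Fin.val h
          simp at this
      · have e1 : i.succ = Fin.last m := Fin.ext (by rw [Fin.val_succ, Fin.val_last]; omega)
        refine mem (k := ⟨0, by omega⟩) (hw i).1 ?_ fun h => by
          have := congrArg Fin.val h
          simp only at this
          omega
        have := (hw i).2
        rwa [e1, ← hv0] at this
    -- The preceding edge of the cycle, which is the last edge when `i = 0`.
    have h2 : ∃ j : Fin m, j ≠ i ∧ v i.castSucc ∈ B (e j) := by
      by_cases h0 : (i : ℕ) = 0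
      · have e1 : (⟨m - 1, by omega⟩ : Fin m).succ = Fin.last m :=
          Fin.ext (by rw [Fin.val_succ, Fin.val_last]; simp only; omega)
        have hne : (⟨m - 1, by omega⟩ : Fin m) ≠ i := fun h => by
          have := congrArg Fin.val h
          simp only at this
          omega
        refine ⟨⟨m - 1, by omega⟩, hne, mem ?_ (hw _).1 hne⟩
        have e2 : i.castSucc = 0 := Fin.ext h0
        rw [e2, hv0, ← e1]
        exact (hw _).2
      · have e1 : (⟨i - 1, by omega⟩ : Fin m).succ = i.castSucc :=
          Fin.ext (by rw [Fin.val_succ, Fin.val_castSucc]; simp only; omega)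
        have hne : (⟨i - 1, by omega⟩ : Fin m) ≠ i := fun h => by
          have := congrArg Fin.val h
          simp only at this
          omega
        refine ⟨⟨i - 1, by omega⟩, hne, mem ?_ (hw _).1 hne⟩
        rw [← e1]
        exact (hw _).2
    obtain ⟨j, hj, h2⟩ := h2
    exact hj (he (h.eq_of_mem h2 h1))

/-- A rooted forest with a single root is determined by its edges and its root. -/
theorem IsRootedForest.ext_of_insert {V E : Type*} [DecidableEq V] {B B' : E → Finset V}
    {p p' : E → V} (h : IsRootedForest B p) (h' : IsRootedForest B' p') {r : V}
    (hr : ∀ v, v = r ↔ ∀ e, v ∉ B e) (hr' : ∀ v, v = r ↔ ∀ e, v ∉ B' e)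
    (hE : ∀ e, insert (p e) (B e) = insert (p' e) (B' e)) : B = B' ∧ p = p' := by
  have eqB {e : E} (hp : p e = p' e) : B e = B' e := by
    rw [← Finset.erase_insert (h.parent_notMem e), hE, hp,
      Finset.erase_insert (h'.parent_notMem e)]
  obtain ⟨d, hd⟩ := h.2
  -- Induction on the rank of the parent: if `p e ≠ p' e`, then `p e` is a child in `B' e`, hence
  -- not `r`, hence in some `B f` with a parent of lower rank. There `B f = B' f`, which forces `e =
  -- f`.
  have key (n : ℕ) : ∀ e, d (p e) = n → p e = p' e := by
    induction n using Nat.strong_induction_on with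
    | _ n ih =>
      rintro e rfl
      by_contra hne
      have h1 : p e ∈ B' e := by
        have := Finset.mem_insert_self (p e) (B e)
        rw [hE, Finset.mem_insert] at this
        exact this.resolve_left hne
      have h2 : ¬ ∀ f, p e ∉ B f := fun hf => (hr' _).1 ((hr _).2 hf) e h1
      push Not at h2
      obtain ⟨f, hf⟩ := h2
      have h3 := eqB (ih _ (hd f _ hf) f rfl)
      have := h'.eq_of_mem h1 (h3 ▸ hf)
      subst this
      exact h.parent_notMem e hf
  have hp : p = p' := funext fun e => key _ e rfl
  exact ⟨funext fun e => eqB (congrFun hp e), hp⟩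

/-- Rooted forests with exactly one root. -/
abbrev SingleRootedForest (V : Type*) {E : Type*} (s : E → ℕ) : Type _ :=
  {y : RootedForest V s × V // ∀ v, v = y.2 ↔ ∀ e, v ∉ y.1.1.1 e}

/-- The number of roots is fixed by the sizes, so either all forests with these sizes have a single
root or none does. -/
theorem SingleRootedForest.card_mul_prod_factorial (V : Type*) [Fintype V] (E : Type*) [Fintype E]
    (s : E → ℕ) :
    Nat.card (SingleRootedForest V s) * ∏ e, (s e).factorial =
      if ∑ e, s e + 1 = Fintype.card V
      then Fintype.card V ^ Fintype.card E * (Fintype.card V - 1).factorial else 0 := by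
  classical
  split_ifs with h
  · have hb : Function.Bijective fun y : SingleRootedForest V s => y.1.1 := by
      constructor
      · rintro ⟨⟨F, r⟩, hr⟩ ⟨⟨F', r'⟩, hr'⟩ (rfl : F = F')
        have : r = r' := (hr' r).2 ((hr r).1 rfl)
        subst this
        rfl
      · intro F
        have hc : (rootSet F.1.1).card = 1 := by rw [F.card_rootSet]; omega
        obtain ⟨r, hr⟩ := Finset.card_eq_one.1 hc
        exact ⟨⟨(F, r), fun v => by rw [← mem_rootSet, hr, Finset.mem_singleton]⟩, rfl⟩
    rw [Nat.card_congr (Equiv.ofBijective _ hb), RootedForest.card_mul_prod_factorial,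
      ← Nat.descFactorial_self, ← h, Nat.add_sub_cancel]
  · have : IsEmpty (SingleRootedForest V s) := by
      refine ⟨fun ⟨⟨F, r⟩, hr⟩ => h ?_⟩
      have hc : rootSet F.1.1 = {r} := by
        ext v
        rw [mem_rootSet, Finset.mem_singleton, hr v]
      have := F.card_rootSet
      rw [hc, Finset.card_singleton] at this
      omega
    rw [Nat.card_of_isEmpty, zero_mul]

/-- The hypergraph of a rooted forest. -/
def RootedForest.toLabeledHypergraph {n : ℕ} {lam : ℕ →₀ ℕ}
    (hlam : ∀ x : (Σ i : ℕ, Fin (lam i)), 2 ≤ x.1)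
    (F : RootedForest (Fin n) fun x : (Σ i : ℕ, Fin (lam i)) => x.1 - 1) :
    LabeledHypergraph n lam :=
  have h (x : Σ i : ℕ, Fin (lam i)) : (insert (F.1.2 x) (F.1.1 x)).card = x.1 := by
    rw [Finset.card_insert_of_notMem (F.2.1.parent_notMem x), F.2.2]
    exact Nat.sub_add_cancel (one_le_two.trans (hlam x))
  { verts := fun x => insert (F.1.2 x) (F.1.1 x)
    two_le_card := fun x => by rw [h]; exact hlam x
    card_verts := h }

theorem rootedHypertreeCount_eq_card {n : ℕ} {lam : ℕ →₀ ℕ}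
    (hlam : ∀ x : (Σ i : ℕ, Fin (lam i)), 2 ≤ x.1) :
    rootedHypertreeCount n lam =
      Nat.card (SingleRootedForest (Fin n) fun x : (Σ i : ℕ, Fin (lam i)) => x.1 - 1) := by
  let f : SingleRootedForest (Fin n) (fun x : (Σ i : ℕ, Fin (lam i)) => x.1 - 1) →
      {p : LabeledHypergraph n lam × Fin n // p.1.toMultiHypergraph.IsHypertree} :=
    fun y => ⟨(y.1.1.toLabeledHypergraph hlam, y.1.2),
      y.1.1.2.1.isHypertree y.2 fun _ => rfl⟩
  refine (Nat.card_congr (Equiv.ofBijective f ⟨?_, ?_⟩)).symm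
  · rintro ⟨⟨F, r⟩, hr⟩ ⟨⟨F', r'⟩, hr'⟩ h
    have h1 : F.toLabeledHypergraph hlam = F'.toLabeledHypergraph hlam :=
      congrArg (fun p => p.1.1) h
    have h2 : r = r' := congrArg (fun p => p.1.2) h
    subst h2
    have h3 := F.2.1.ext_of_insert F'.2.1 hr hr' fun e =>
      congrFun (congrArg (fun H => H.verts) h1) e
    have h4 : F = F' := Subtype.ext (Prod.ext h3.1 h3.2)
    subst h4
    rfl
  · rintro ⟨⟨H, r⟩, hH⟩
    obtain ⟨B, p, hF, hr, hp, hE⟩ := hH.exists_isRootedForest r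
    have hB (x : Σ i : ℕ, Fin (lam i)) : (B x).card = x.1 - 1 := by
      rw [← H.card_verts x, hE, Finset.card_insert_of_notMem (hp x), Nat.add_sub_cancel]
    refine ⟨⟨(⟨(B, p), hF, hB⟩, r), hr⟩, Subtype.ext (Prod.ext ?_ rfl)⟩
    exact LabeledHypergraph.ext (funext fun x => (hE x).symm)

theorem univ_edgeLabels (lam : ℕ →₀ ℕ) [Fintype (Σ i : ℕ, Fin (lam i))] :
    (Finset.univ : Finset (Σ i : ℕ, Fin (lam i))) =
      lam.support.sigma fun i => (Finset.univ : Finset (Fin (lam i))) := by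
  ext ⟨i, a⟩
  simp only [Finset.mem_univ, Finset.mem_sigma, Finsupp.mem_support_iff, and_true, true_iff]
  have := a.isLt
  omega

theorem prod_edgeLabels (lam : ℕ →₀ ℕ) [Fintype (Σ i : ℕ, Fin (lam i))] (g : ℕ → ℕ) :
    ∏ x : (Σ i : ℕ, Fin (lam i)), g x.1 = lam.prod fun i k => g i ^ k := by
  rw [univ_edgeLabels, Finset.prod_sigma]
  simp [Finsupp.prod]

theorem sum_edgeLabels (lam : ℕ →₀ ℕ) [Fintype (Σ i : ℕ, Fin (lam i))] (g : ℕ → ℕ) :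
    ∑ x : (Σ i : ℕ, Fin (lam i)), g x.1 = lam.sum fun i k => k * g i := by
  rw [univ_edgeLabels, Finset.sum_sigma]
  simp [Finsupp.sum]

theorem rootedHypertreeCount_mul_prod_factorial {n : ℕ} {lam : ℕ →₀ ℕ} (h0 : lam 0 = 0)
    (h1 : lam 1 = 0) :
    rootedHypertreeCount n lam * lam.prod (fun i k => (i - 1).factorial ^ k) =
      if edgeWeight lam + 1 = n then n ^ lam.degree * (n - 1).factorial else 0 := by
  have := Fintype.ofFinite (Σ i : ℕ, Fin (lam i))
  have hlam (x : Σ i : ℕ, Fin (lam i)) : 2 ≤ x.1 := by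
    obtain ⟨_ | _ | i, a⟩ := x
    · exact absurd a.isLt (by omega)
    · exact absurd a.isLt (by simp [h1])
    · simp
  have hcard : Fintype.card (Σ i : ℕ, Fin (lam i)) = lam.degree := by
    simpa [Finsupp.degree_apply, Finsupp.sum] using sum_edgeLabels lam fun _ => 1
  rw [rootedHypertreeCount_eq_card hlam, ← prod_edgeLabels lam fun i => (i - 1).factorial,
    SingleRootedForest.card_mul_prod_factorial, Fintype.card_fin, hcard,
    sum_edgeLabels lam fun i => i - 1]
  rfl

theorem rootedHypertreeCount_eq_zero {n : ℕ} {lam : ℕ →₀ ℕ} (h : ¬ (lam 0 = 0 ∧ lam 1 = 0)) :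
    rootedHypertreeCount n lam = 0 := by
  have key (i : ℕ) (hi : i < 2) (hl : lam i ≠ 0) : IsEmpty (LabeledHypergraph n lam) := by
    refine ⟨fun H => ?_⟩
    have h1 := H.card_verts ⟨i, ⟨0, by omega⟩⟩
    have h2 := H.two_le_card ⟨i, ⟨0, by omega⟩⟩
    simp only at h1
    omega
  have : IsEmpty (LabeledHypergraph n lam) := by
    by_cases h0 : lam 0 = 0
    · exact key 1 (by omega) fun h1 => h ⟨h0, h1⟩
    · exact key 0 (by omega) h0
  exact Nat.card_of_isEmpty

/-! ### The generating functions and the functional equation. -/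

theorem rootedHypertreeCount_eq_mul (n : ℕ) (lam : ℕ →₀ ℕ) :
    rootedHypertreeCount n lam = n * hypertreeCount n lam := by
  have e : {p : LabeledHypergraph n lam × Fin n // p.1.toMultiHypergraph.IsHypertree} ≃
      {H : LabeledHypergraph n lam // H.toMultiHypergraph.IsHypertree} × Fin n :=
    { toFun := fun p => (⟨p.1.1, p.2⟩, p.1.2)
      invFun := fun q => ⟨(q.1.1, q.2), q.1.2⟩
      left_inv := fun _ => rfl
      right_inv := fun _ => rfl }
  rw [rootedHypertreeCount, hypertreeCount, Nat.card_congr e, Nat.card_prod, Nat.card_fin,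
    mul_comm]

theorem coeff_egf (c : ℕ → (ℕ →₀ ℕ) → ℕ) (n : ℕ) (lam : ℕ →₀ ℕ) :
    MvPowerSeries.coeff lam (PowerSeries.coeff n (egf c)) =
      (c n lam : ℚ) / ((n.factorial : ℚ) * lam.prod fun _ k => (k.factorial : ℚ)) := by
  rw [egf, PowerSeries.coeff_mk, EdgeRing.coeff_ofCoeff]

theorem constantCoeff_rootedHypertreeEGF :
    PowerSeries.constantCoeff rootedHypertreeEGF = 0 := by
  rw [← PowerSeries.coeff_zero_eq_constantCoeff_apply]
  ext lam
  rw [rootedHypertreeEGF, coeff_egf, rootedHypertreeCount_eq_mul]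
  simp

theorem rootedHypertreeEGF_eq_X_mul_derivative :
    rootedHypertreeEGF = PowerSeries.X * PowerSeries.derivative EdgeRing hypertreeEGF := by
  ext n lam
  cases n with
  | zero => simp [constantCoeff_rootedHypertreeEGF]
  | succ n =>
    rw [PowerSeries.coeff_succ_X_mul, PowerSeries.coeff_derivative, mul_comm, ← Nat.cast_add_one,
      ← nsmul_eq_mul, map_nsmul, nsmul_eq_mul, rootedHypertreeEGF, hypertreeEGF, coeff_egf,
      coeff_egf, if_neg n.succ_ne_zero, rootedHypertreeCount_eq_mul]
    push_cast
    ring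

/-- The hypothesis of Lagrange inversion, obtained by matching the explicit count with the
coefficients of `expEdgePow`. -/
theorem nsmul_coeff_rootedHypertreeEGF (n : ℕ) :
    (n + 1) • PowerSeries.coeff (n + 1) rootedHypertreeEGF =
      PowerSeries.coeff n (expEdgePow (n + 1)) := by
  ext lam
  rw [map_nsmul, nsmul_eq_mul, rootedHypertreeEGF, coeff_egf, coeff_expEdgePow]
  by_cases hl : lam 0 = 0 ∧ lam 1 = 0
  · have h := rootedHypertreeCount_mul_prod_factorial (n := n + 1) hl.1 hl.2
    have hD : edgeDenom lam =
        lam.prod (fun _ k => k.factorial) * lam.prod fun i k => (i - 1).factorial ^ k :=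
      Finsupp.prod_mul
    have hP : (lam.prod fun _ k => (k.factorial : ℚ)) =
        ((lam.prod fun _ k => k.factorial : ℕ) : ℚ) := by
      simp [Finsupp.prod]
    have hpos := (edgeDenom_pos lam).ne'
    rw [hP, hD]
    rw [hD] at hpos
    generalize lam.prod (fun _ k => k.factorial) = P at *
    generalize lam.prod (fun i k => (i - 1).factorial ^ k) = Q at *
    have hP0 : (P : ℚ) ≠ 0 := by exact_mod_cast (mul_ne_zero_iff.1 hpos).1
    have hQ0 : (Q : ℚ) ≠ 0 := by exact_mod_cast (mul_ne_zero_iff.1 hpos).2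
    have hn0 : (n.factorial : ℚ) ≠ 0 := by exact_mod_cast n.factorial_ne_zero
    have hn1 : (n : ℚ) + 1 ≠ 0 := by positivity
    by_cases hw : edgeWeight lam = n
    · rw [if_pos (by omega), Nat.add_sub_cancel] at h
      rw [if_pos ⟨hl.1, hl.2, hw⟩, Nat.factorial_succ]
      have h' : (rootedHypertreeCount (n + 1) lam : ℚ) * Q =
          ((n : ℚ) + 1) ^ lam.degree * n.factorial := by exact_mod_cast h
      push_cast
      field_simp
      linear_combination h'
    · rw [if_neg (by omega)] at h
      have h0 := (Nat.mul_eq_zero.1 h).resolve_right (mul_ne_zero_iff.1 hpos).2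
      rw [if_neg fun h => hw h.2.2, h0]
      simp
  · rw [rootedHypertreeCount_eq_zero hl, if_neg fun h => hl ⟨h.1, h.2.1⟩]
    simp

/-- Let `T` and `R` be the exponential generating functions of labeled hypertrees and of
vertex-rooted labeled hypertrees. Then `R = t * ∂T/∂t`, the substitutions below are legitimate, and
`R = t * exp (∑_{j ≥ 1} u (j + 1) * R ^ j / j!)`. -/
theorem mainTheorem3 :
    rootedHypertreeEGF = PowerSeries.X * PowerSeries.derivative EdgeRing hypertreeEGF ∧
    PowerSeries.HasSubst rootedHypertreeEGF ∧
    PowerSeries.HasSubst (PowerSeries.subst rootedHypertreeEGF edgeSeries : PowerSeries EdgeRing) ∧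
    rootedHypertreeEGF =
      PowerSeries.X *
        (PowerSeries.subst
          (PowerSeries.subst rootedHypertreeEGF edgeSeries : PowerSeries EdgeRing)
          (PowerSeries.exp EdgeRing) : PowerSeries EdgeRing) := by
  have hR : PowerSeries.HasSubst rootedHypertreeEGF :=
    PowerSeries.HasSubst.of_constantCoeff_zero' constantCoeff_rootedHypertreeEGF
  refine ⟨rootedHypertreeEGF_eq_X_mul_derivative, hR, ?_, ?_⟩
  · exact PowerSeries.HasSubst.of_constantCoeff_zero
      (PowerSeries.constantCoeff_subst_eq_zero constantCoeff_rootedHypertreeEGF _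
        (by simp [edgeSeries]))
  -- Reassociate to `(exp ∘ edgeSeries) ∘ R`, so that `φ = exp ∘ edgeSeries`.
  · rw [← PowerSeries.subst_comp_subst_apply hasSubst_edgeSeries hR]
    exact PowerSeries.eq_X_mul_subst_of_coeff_pow constantCoeff_exp_subst_edgeSeries
      constantCoeff_rootedHypertreeEGF fun n => by
        rw [exp_subst_edgeSeries_pow, nsmul_coeff_rootedHypertreeEGF]
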